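/- Let $N\ge 1$, let $\Omega\subseteq\mathbb{R}^N$ be open with finite measure, let $1\le p<\infty$ and let $p'\in\,]1,\infty]$ be the conjugate exponent ($p'=\infty$ if $p=1$). Here $W^{1,p}_0(\Omega)$ is the closure of $C^\infty_c(\Omega)$ in $W^{1,p}(\Omega)$, $Du$ is the weak gradient, and $(\cdot,\cdot)$, $|\cdot|$ are the Euclidean scalar product and norm. Assume that: 1. $H:\mathbb{R}^N\to[0,\infty[$ is convex and, for some $0\le c<d<\infty$, $c\,|z|^p\le H(z)\le d\,|z|^p$ for all $z\in\mathbb{R}^N$; 2. $f:\Omega\times\mathbb{R}\to\mathbb{R}$ is a Carathéodory function with $\sup_{|s|\le t}\|f(\cdot,s)\|_{L^\infty(\Omega)}<\infty$ for every $t>0$; 3. if $p\le N$, there are $\theta,\mu\ge 0$ and a finite $q\ge 1$, with $q\le \frac{Np}{N-p}$ when $p<N$, such that $\mathrm{sign}(t)\,f(x,t)\le\mu\,(|t|+\theta)^{q-1}$ for a.e. $x\in\Omega$ and all $t\in\mathbb{R}$. Put $F(x,t)=\int_0^t f(x,s)\,ds$ and $J(v)=\int_\Omega H(Dv)-F(x,v)\,dx\in\,]-\infty,\infty]$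 for $v\in W^{1,p}_0(\Omega)$. For $u\in W^{1,p}_0(\Omega)$ let $$V_u=\{v\in W^{1,p}_0(\Omega): f(\cdot,u)\,v\in L^1(\Omega)\}.$$ Call $u$ an energy critical point of $J$ if $J(u)<\infty$, $u\in V_u$, and $u$ minimises $J_u(v)=\int_\Omega H(Dv)-f(x,u)\,v\,dx$ over $v\in V_u$. Let $\partial H(z)=\{\xi\in\mathbb{R}^N: H(z+v)-H(z)\ge(\xi,v)\ \forall v\in\mathbb{R}^N\}$. Let $u\in W^{1,p}_0(\Omega)$ be an energy critical point of $J$. Then there exists $\xi\in L^{p'}(\Omega;\mathbb{R}^N)$ such that $$\xi(x)\in\partial H(Du(x))\ \text{ for a.e. }x\in\Omega,\qquad \int_\Omega(\xi,D\varphi)-f(x,u)\,\varphi\,dx=0\quad\forall\varphi\in V_u.\tag{EL}$$ If moreover $H$ is positively $p$-homogeneous, i.e. $H(\lambda z)=\lambda^pH(z)$ for all $\lambda>0$ and $z\in\mathbb{R}^N$, then every $\xi\in L^{p'}(\Omega;\mathbb{R}^N)$ satisfying (EL) fulfils $(\xi,Du)=p\,H(Du)$ a.e. in $\Omega$, and $$p\int_\Omega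 H(Du)\,dx=\int_\Omega f(x,u)\,u\,dx.$$ -/

import Mathlib

open MeasureTheory Filter Topology
open scoped ENNReal ContDiff

namespace EnergyCritical

noncomputable section

/-- The Euclidean space `ℝ^N`. -/
abbrev E (N : ℕ) : Type := EuclideanSpace ℝ (Fin N)

/-- `φ ∈ C^∞_c(Ω)`. -/
structure IsTest {N : ℕ} (Ω : Set (E N)) (φ : E N → ℝ) : Prop where
  smooth : ContDiff ℝ ∞ φ
  compact : HasCompactSupport φ
  supp : tsupport φ ⊆ Ω

/-- `G` is the weak (distributional) gradient of `u` in `Ω`. It is only used for `u` and `G`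
in `L^p(Ω)`, so that all the integrals converge. -/
def IsWeakGrad {N : ℕ} (Ω : Set (E N)) (u : E N → ℝ) (G : E N → E N) : Prop :=
  ∀ φ : E N → ℝ, IsTest Ω φ →
    ∫ x in Ω, u x • gradient φ x = - ∫ x in Ω, φ x • G x

/-- An element of `W^{1,p}_0(Ω)`, the closure of `C^∞_c(Ω)` in `W^{1,p}(Ω)`: (a representative of)
a function in `L^p(Ω)` together with (a representative of) its weak gradient `Du ∈ L^p(Ω; ℝ^N)`,
which is almost everywhere determined by the function. When `Ω` has finite measure
the Poincaré inequality makes `‖Du‖_p` and the full Sobolev norm equivalent on `C^∞_c(Ω)`,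
so that this is also the closure for `‖Du‖_p`. Values outside `Ω` are irrelevant. -/
structure W0 {N : ℕ} (Ω : Set (E N)) (p : ℝ) where
  /-- the function `u` -/
  toFun : E N → ℝ
  /-- the weak gradient `Du` -/
  grad : E N → E N
  memLp : MemLp toFun (ENNReal.ofReal p) (volume.restrict Ω)
  memLp_grad : MemLp grad (ENNReal.ofReal p) (volume.restrict Ω)
  isWeakGrad : IsWeakGrad Ω toFun grad
  approx : ∃ φ : ℕ → E N → ℝ, (∀ n, IsTest Ω (φ n)) ∧
    Tendsto (fun n => eLpNorm (fun x => φ n x - toFun x) (ENNReal.ofReal p)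
      (volume.restrict Ω)) atTop (𝓝 0) ∧
    Tendsto (fun n => eLpNorm (fun x => gradient (φ n) x - grad x) (ENNReal.ofReal p)
      (volume.restrict Ω)) atTop (𝓝 0)

/-- The convex subdifferential `∂H(z) ⊆ ℝ^N`. -/
def subdiff {N : ℕ} (H : E N → ℝ) (z : E N) : Set (E N) :=
  {ξ | ∀ v : E N, inner ℝ ξ v ≤ H (z + v) - H z}

/-- `H : ℝ^N → [0, ∞[` is convex and `c |z|^p ≤ H(z) ≤ d |z|^p`, where `0 ≤ c < d < ∞`. -/
structure GrowthH {N : ℕ} (H : E N → ℝ) (p c d : ℝ) : Prop where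
  nonneg : ∀ z, 0 ≤ H z
  convex : ConvexOn ℝ Set.univ H
  c_nonneg : 0 ≤ c
  c_lt_d : c < d
  lower : ∀ z, c * ‖z‖ ^ p ≤ H z
  upper : ∀ z, H z ≤ d * ‖z‖ ^ p

/-- `H(λ z) = λ^p H(z)` for all `λ > 0`. -/
def PosHomogeneous {N : ℕ} (H : E N → ℝ) (p : ℝ) : Prop :=
  ∀ l : ℝ, 0 < l → ∀ z : E N, H (l • z) = l ^ p * H z

/-- `f : Ω × ℝ → ℝ` is a Carathéodory function (Lebesgue measurable in `x`, continuous in `t`) and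
`sup_{|s| ≤ t} ‖f(·, s)‖_{L^∞(Ω)} < ∞` for all `t > 0`. -/
structure LocBddCaratheodory {N : ℕ} (Ω : Set (E N)) (f : E N → ℝ → ℝ) : Prop where
  meas : ∀ s : ℝ, AEMeasurable (fun x => f x s) (volume.restrict Ω)
  cont : ∀ᵐ x ∂(volume.restrict Ω), Continuous (f x)
  bdd : ∀ t : ℝ, 0 < t → ∃ M : ℝ, ∀ s : ℝ, |s| ≤ t →
    ∀ᵐ x ∂(volume.restrict Ω), |f x s| ≤ M

/-- The one-sided growth condition `sign(t) f(x, t) ≤ μ (|t| + θ)^{q - 1}` for some `θ, μ ≥ 0` and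
some finite `q` with `1 ≤ q ≤ p^*`. It is only used for `p ≤ N`; here `p^* = N p / (N - p)` if
`p < N`, while any finite `q ≥ 1` is allowed if `p = N`. -/
def OneSidedGrowth {N : ℕ} (Ω : Set (E N)) (p : ℝ) (f : E N → ℝ → ℝ) : Prop :=
  ∃ θ μ q : ℝ, 0 ≤ θ ∧ 0 ≤ μ ∧ 1 ≤ q ∧ (p < N → q ≤ N * p / (N - p)) ∧
    ∀ᵐ x ∂(volume.restrict Ω), ∀ t : ℝ, Real.sign t * f x t ≤ μ * (|t| + θ) ^ (q - 1)

/-- `F(x, t) = ∫_0^t f(x, s) ds`. -/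
def primF {N : ℕ} (f : E N → ℝ → ℝ) (x : E N) (t : ℝ) : ℝ := ∫ s in (0 : ℝ)..t, f x s

/-- The functional `J(v) = ∫_Ω H(Dv) - F(x, v) dx`, as the integral of the positive part minus
the integral of the negative part; the latter is finite under the structural assumptions, so that
`J` takes values in `]-∞, ∞]`. -/
def J {N : ℕ} {Ω : Set (E N)} {p : ℝ} (H : E N → ℝ) (f : E N → ℝ → ℝ) (v : W0 Ω p) : EReal :=
  ((∫⁻ x in Ω, ENNReal.ofReal (H (v.grad x) - primF f x (v.toFun x)) : ℝ≥0∞) : EReal) -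
    ((∫⁻ x in Ω, ENNReal.ofReal (-(H (v.grad x) - primF f x (v.toFun x))) : ℝ≥0∞) : EReal)

/-- `V_u = {v ∈ W^{1,p}_0(Ω) : f(·, u) v ∈ L^1(Ω)}`. -/
def V {N : ℕ} {Ω : Set (E N)} {p : ℝ} (f : E N → ℝ → ℝ) (u : W0 Ω p) : Set (W0 Ω p) :=
  {v | Integrable (fun x => f x (u.toFun x) * v.toFun x) (volume.restrict Ω)}

/-- The semilinearised functional `J_u(v) = ∫_Ω H(Dv) - f(x, u) v dx`, used for `v ∈ V_u`. Since
`H(z) ≤ d |z|^p` with `d < ∞`, the integrand is then integrable. -/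
def Jlin {N : ℕ} {Ω : Set (E N)} {p : ℝ} (H : E N → ℝ) (f : E N → ℝ → ℝ) (u v : W0 Ω p) : ℝ :=
  ∫ x in Ω, (H (v.grad x) - f x (u.toFun x) * v.toFun x)

/-- `u` is an energy critical point of `J`: `J(u) < ∞`, `u ∈ V_u`, and `u` minimises
`J_u` on `V_u`. -/
structure IsEnergyCritical {N : ℕ} {Ω : Set (E N)} {p : ℝ} (H : E N → ℝ) (f : E N → ℝ → ℝ)
    (u : W0 Ω p) : Prop where
  finite : J H f u < ⊤
  mem : u ∈ V f u
  min : ∀ v ∈ V f u, Jlin H f u u ≤ Jlin H f u v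

/-- `ξ ∈ L^{p'}(Ω; ℝ^N)` solves the Euler-Lagrange inclusion: `ξ(x) ∈ ∂H(Du(x))` almost everywhere
in `Ω` and `∫_Ω (ξ, Dφ) - f(x, u) φ dx = 0` for all `φ ∈ V_u`. -/
structure SolvesEL {N : ℕ} {Ω : Set (E N)} {p : ℝ} (H : E N → ℝ) (f : E N → ℝ → ℝ)
    (u : W0 Ω p) (ξ : E N → E N) : Prop where
  memLp : MemLp ξ (ENNReal.conjExponent (ENNReal.ofReal p)) (volume.restrict Ω)
  mem_subdiff : ∀ᵐ x ∂(volume.restrict Ω), ξ x ∈ subdiff H (u.grad x)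
  eq : ∀ φ ∈ V f u,
    ∫ x in Ω, (inner ℝ (ξ x) (φ.grad x) - f x (u.toFun x) * φ.toFun x) = 0

end

end EnergyCritical

/-! Comparing `u` with `u + w` for `w ∈ V_u` gives `∫ f(x,u) w ≤ Φ(Du + Dw) - Φ(Du)`, where `Φ(g) =
∫ H(g)` is a finite convex function on `L^p(Ω; ℝ^N)`. Applied to `w` and `-w`, this shows that `∫
f(x,u) w` depends only on `Dw`, so it defines a linear functional on the subspace of gradients,
lying below the convex increment of `Φ` at `Du`. Hahn–Banach (`exists_extension_of_le_convex`)
extends it to all of `L^p` under the same bound: the extension is a subgradient of `Φ` at `Du`. The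
growth of `H` makes it continuous, Radon–Nikodym gives it a density `ξ`, and testing with `v 1_s`
turns the integral inequality into `ξ(x) ∈ ∂H(Du(x))` (`exists_selection_of_le_integral`).
Restricting back to gradients yields the equation. For homogeneous `H`, Euler's identity holds for
every subgradient, and the test function `u` itself gives the integral identity. -/

namespace EnergyCritical

/-! ### Hahn–Banach under a convex majorant -/

section HahnBanach

variable {X : Type*} [AddCommGroup X] [Module ℝ X]

/-- The one-sided directional derivative at the origin, as an infimum of difference quotients. -/
noncomputable def dirDeriv (Ψ : X → ℝ) (g : X) : ℝ := ⨅ t : Set.Ioi (0 : ℝ), Ψ (t.1 • g) / t.1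

/-- The origin is a convex combination of `-g` and `t • g`, which bounds every quotient below by `-Ψ
(-g)`. -/
theorem bddBelow_quotients {Ψ : X → ℝ} (hΨ : ConvexOn ℝ Set.univ Ψ) (h0 : Ψ 0 = 0) (g : X) :
    BddBelow (Set.range fun t : Set.Ioi (0 : ℝ) => Ψ (t.1 • g) / t.1) := by
  refine ⟨-Ψ (-g), ?_⟩
  rintro _ ⟨⟨t, ht⟩, rfl⟩
  have ht : 0 < t := ht
  have h1 : 0 < 1 + t := by positivity
  have h := hΨ.2 (Set.mem_univ (-g)) (Set.mem_univ (t • g))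
    (show 0 ≤ t / (1 + t) by positivity) (show 0 ≤ 1 / (1 + t) by positivity)
    (by field_simp; ring)
  have e : (t / (1 + t)) • -g + (1 / (1 + t)) • t • g = 0 := by
    rw [smul_smul, smul_neg, ← neg_smul, ← add_smul]
    convert zero_smul ℝ g using 2
    field_simp
    ring
  rw [e, h0] at h
  simp only [smul_eq_mul] at h
  have h2 : 0 ≤ t * Ψ (-g) + Ψ (t • g) := by
    have := mul_nonneg h1.le h
    field_simp at this
    linarith
  change -Ψ (-g) ≤ Ψ (t • g) / t
  rw [le_div_iff₀ ht]
  linarith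

theorem dirDeriv_le {Ψ : X → ℝ} (hΨ : ConvexOn ℝ Set.univ Ψ) (h0 : Ψ 0 = 0) (g : X) {t : ℝ}
    (ht : 0 < t) : dirDeriv Ψ g ≤ Ψ (t • g) / t :=
  ciInf_le (bddBelow_quotients hΨ h0 g) ⟨t, ht⟩

theorem le_dirDeriv {Ψ : X → ℝ} {g : X} {a : ℝ} (h : ∀ t : ℝ, 0 < t → a ≤ Ψ (t • g) / t) :
    a ≤ dirDeriv Ψ g :=
  have : Nonempty (Set.Ioi (0 : ℝ)) := ⟨⟨1, Set.mem_Ioi.2 one_pos⟩⟩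
  le_ciInf fun t => h t.1 t.2

theorem dirDeriv_smul_le {Ψ : X → ℝ} (hΨ : ConvexOn ℝ Set.univ Ψ) (h0 : Ψ 0 = 0) {c : ℝ}
    (hc : 0 < c) (g : X) : c * dirDeriv Ψ g ≤ dirDeriv Ψ (c • g) := by
  refine le_dirDeriv fun t ht => ?_
  have := dirDeriv_le hΨ h0 g (mul_pos ht hc)
  rw [smul_smul]
  calc c * dirDeriv Ψ g ≤ c * (Ψ ((t * c) • g) / (t * c)) := by gcongr
    _ = _ := by field_simp

theorem dirDeriv_smul {Ψ : X → ℝ} (hΨ : ConvexOn ℝ Set.univ Ψ) (h0 : Ψ 0 = 0) {c : ℝ}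
    (hc : 0 < c) (g : X) : dirDeriv Ψ (c • g) = c * dirDeriv Ψ g := by
  refine le_antisymm ?_ (dirDeriv_smul_le hΨ h0 hc g)
  have := dirDeriv_smul_le hΨ h0 (inv_pos.2 hc) (c • g)
  rwa [smul_smul, inv_mul_cancel₀ hc.ne', one_smul, inv_mul_le_iff₀ hc] at this

theorem dirDeriv_add_le {Ψ : X → ℝ} (hΨ : ConvexOn ℝ Set.univ Ψ) (h0 : Ψ 0 = 0) (g h : X) :
    dirDeriv Ψ (g + h) ≤ dirDeriv Ψ g + dirDeriv Ψ h := by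
  rw [← sub_le_iff_le_add]
  refine le_dirDeriv fun s hs => ?_
  rw [sub_le_comm]
  refine le_dirDeriv fun t ht => ?_
  rw [sub_le_iff_le_add]
  -- With this step length, `r • (g + h)` is a convex combination of `s • g` and `t • h`, so no
  -- monotonicity of the quotients is needed.
  have hr : 0 < s * t / (s + t) := by positivity
  refine (dirDeriv_le hΨ h0 (g + h) hr).trans ?_
  have hc := hΨ.2 (Set.mem_univ (s • g)) (Set.mem_univ (t • h)) 
    (show 0 ≤ t / (s + t) by positivity) (show 0 ≤ s / (s + t) by positivity) (by field_simp; ring)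
  have e : (t / (s + t)) • s • g + (s / (s + t)) • t • h = (s * t / (s + t)) • (g + h) := by
    rw [smul_smul, smul_smul, smul_add]
    congr 2 <;> ring
  rw [e] at hc
  rw [div_le_iff₀ hr]
  refine hc.trans (le_of_eq ?_)
  simp only [smul_eq_mul]
  field_simp
  ring

/-- **Hahn–Banach theorem** for a linear functional dominated by a convex function. -/
theorem exists_extension_of_le_convex {Φ : X → ℝ} (hΦ : ConvexOn ℝ Set.univ Φ) (x₀ : X)
    (l : X →ₗ.[ℝ] ℝ) (hl : ∀ w : l.domain, l w ≤ Φ (x₀ + w) - Φ x₀) :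
    ∃ L : X →ₗ[ℝ] ℝ, (∀ w : l.domain, L w = l w) ∧ ∀ g, L g ≤ Φ (x₀ + g) - Φ x₀ := by
  set Ψ : X → ℝ := fun g => Φ (x₀ + g) - Φ x₀ with hΨdef
  have hΨ : ConvexOn ℝ Set.univ Ψ := by
    have := (hΦ.translate_right x₀).sub (concaveOn_const (Φ x₀) convex_univ)
    simpa using! this
  have h0 : Ψ 0 = 0 := by simp [hΨdef]
  have hle : ∀ w : l.domain, l w ≤ dirDeriv Ψ w := fun w => le_dirDeriv fun t ht => by
    rw [le_div_iff₀ ht]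
    have := hl (t • w)
    rw [l.map_smul] at this
    simpa [mul_comm] using this
  obtain ⟨L, hL, hL'⟩ := exists_extension_of_le_sublinear l (dirDeriv Ψ)
    (fun c hc g => dirDeriv_smul hΨ h0 hc g) (dirDeriv_add_le hΨ h0) hle
  refine ⟨L, hL, fun g => (hL' g).trans ?_⟩
  simpa using dirDeriv_le hΨ h0 g one_pos

end HahnBanach

/-! ### Densities of functionals on `L^p` over a finite measure space -/

section Representation

variable {α : Type*} [MeasurableSpace α] {μ : Measure α} [IsFiniteMeasure μ] {p : ℝ≥0∞}
  [hp : Fact (1 ≤ p)] {F : Type*} [NormedAddCommGroup F] [NormedSpace ℝ F]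

/-- A functional on `L^p` is countably additive on indicators with a fixed value. -/
theorem hasSum_indicatorConstLp (hp' : p ≠ ⊤) (L : Lp F p μ →L[ℝ] ℝ) (v : F) {s : ℕ → Set α}
    (hs : ∀ i, MeasurableSet (s i)) (hd : Pairwise (Function.onFun Disjoint s)) :
    HasSum (fun i => L (indicatorConstLp p (hs i) (measure_ne_top μ _) v))
      (L (indicatorConstLp p (MeasurableSet.iUnion hs) (measure_ne_top μ _) v)) := by
  refine HasSum.mapL (φ := L) (f := fun i => indicatorConstLp p (hs i) (measure_ne_top μ _) v) ?_
  have hfin : ∀ T : Finset ℕ, MeasurableSet (⋃ i ∈ T, s i) := fun T =>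
    T.measurableSet_biUnion fun i _ => hs i
  have key : ∀ T : Finset ℕ, ∑ i ∈ T, indicatorConstLp p (hs i) (measure_ne_top μ _) v =
      indicatorConstLp p (hfin T) (measure_ne_top μ _) v := by
    intro T
    classical
    induction T using Finset.induction_on with
    | empty =>
      simp only [Finset.sum_empty, Finset.notMem_empty, Set.iUnion_of_empty, Set.iUnion_empty]
      exact indicatorConstLp_empty.symm
    | insert a T ha ih =>
      rw [Finset.sum_insert ha, ih, ← indicatorConstLp_disjoint_union]
      · congr 1
        rw [Finset.set_biUnion_insert]
      · refine Set.disjoint_iUnion₂_right.2 fun i hi => hd ?_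
        rintro rfl
        exact ha hi
  change Tendsto (fun T : Finset ℕ => ∑ i ∈ T, _) atTop _
  simp only [key]
  refine tendsto_indicatorConstLp_set hp' ?_
  have hsum : ∑' i, μ (s i) ≠ ⊤ := by
    rw [← measure_iUnion hd hs]
    exact measure_ne_top _ _
  -- The symmetric difference is covered by the `s i` with `i ∉ T`, whose total measure is the tail
  -- of a convergent series.
  refine tendsto_of_tendsto_of_tendsto_of_le_of_le tendsto_const_nhds
    (ENNReal.tendsto_tsum_compl_atTop_zero hsum) (fun _ => zero_le) fun T => ?_
  refine (measure_mono ?_).trans (measure_iUnion_le (fun i : {i // i ∉ T} => s i))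
  intro x hx
  rcases hx with ⟨h1, h2⟩ | ⟨h1, h2⟩
  · obtain ⟨i, -, hi⟩ := Set.mem_iUnion₂.1 h1
    exact absurd (Set.mem_iUnion.2 ⟨i, hi⟩) h2
  · obtain ⟨i, hi⟩ := Set.mem_iUnion.1 h1
    exact Set.mem_iUnion.2 ⟨⟨i, fun hT => h2 (Set.mem_iUnion₂.2 ⟨i, hT, hi⟩)⟩, hi⟩

open Classical in
/-- The signed measure `s ↦ L (v 1_s)` induced by a functional on `L^p`. -/
noncomputable def inducedMeasure (hp' : p ≠ ⊤) (L : Lp F p μ →L[ℝ] ℝ) (v : F) :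
    SignedMeasure α where
  measureOf' s := if hs : MeasurableSet s then
    L (indicatorConstLp p hs (measure_ne_top μ _) v) else 0
  empty' := by simp
  not_measurable' s hs := by simp [hs]
  m_iUnion' s hs hd := by
    simp only [hs, MeasurableSet.iUnion hs, dif_pos]
    exact hasSum_indicatorConstLp hp' L v hs hd

theorem inducedMeasure_apply (hp' : p ≠ ⊤) (L : Lp F p μ →L[ℝ] ℝ) (v : F) {s : Set α}
    (hs : MeasurableSet s) :
    inducedMeasure hp' L v s = L (indicatorConstLp p hs (measure_ne_top μ _) v) :=
  dif_pos hs

theorem exists_density (hp' : p ≠ ⊤) (L : Lp F p μ →L[ℝ] ℝ) (v : F) :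
    ∃ g : α → ℝ, Integrable g μ ∧ ∀ s (hs : MeasurableSet s),
      L (indicatorConstLp p hs (measure_ne_top μ _) v) = ∫ x in s, g x ∂μ := by
  have hac : inducedMeasure hp' L v ≪ᵥ μ.toENNRealVectorMeasure := by
    refine VectorMeasure.AbsolutelyContinuous.mk fun s hs h => ?_
    rw [Measure.toENNRealVectorMeasure_apply_measurable hs] at h
    rw [inducedMeasure_apply hp' L v hs]
    convert map_zero L
    rw [← norm_eq_zero, norm_indicatorConstLp (zero_lt_one.trans_le hp.out).ne' hp']
    have : p.toReal ≠ 0 := (ENNReal.toReal_pos (zero_lt_one.trans_le hp.out).ne' hp').ne'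
    simp [Measure.real, h, this]
  refine ⟨(inducedMeasure hp' L v).rnDeriv μ, SignedMeasure.integrable_rnDeriv _ _,
    fun s hs => ?_⟩
  rw [← inducedMeasure_apply hp' L v hs,
    ← withDensityᵥ_apply (SignedMeasure.integrable_rnDeriv _ _) hs,
    SignedMeasure.withDensityᵥ_rnDeriv_eq _ _ hac]

/-- Only integrability of `ξ` is claimed here; membership in `L^{p'}` comes later from the growth of
`H`. -/
theorem exists_vector_density {N : ℕ} (hp' : p ≠ ⊤) (L : Lp (E N) p μ →L[ℝ] ℝ) :
    ∃ ξ : α → E N, Integrable ξ μ ∧ ∀ s (hs : MeasurableSet s) (v : E N),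
      L (indicatorConstLp p hs (measure_ne_top μ _) v) = ∫ x in s, inner ℝ (ξ x) v ∂μ := by
  choose g hg hgL using fun i : Fin N => exists_density hp' L (EuclideanSpace.single i (1 : ℝ))
  refine ⟨fun x => ∑ i, g i x • EuclideanSpace.single i (1 : ℝ),
    integrable_finsetSum _ fun i _ => (hg i).smul_const _, fun s hs v => ?_⟩
  have hv : v = ∑ i, v i • EuclideanSpace.single i (1 : ℝ) := by
    simpa using ((EuclideanSpace.basisFun (Fin N) ℝ).sum_repr v).symm
  let T : E N →ₗ[ℝ] Lp (E N) p μ :=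
    { toFun := indicatorConstLp p hs (measure_ne_top μ s)
      map_add' := fun _ _ => indicatorConstLp_add.symm
      map_smul' := fun a w => by
        rw [indicatorConstLp, indicatorConstLp, RingHom.id_apply, ← MemLp.toLp_const_smul]
        congr 1
        ext1 x
        exact Set.indicator_const_smul_apply s a (fun _ => w) x }
  have h1 : indicatorConstLp p hs (measure_ne_top μ s) v =
      ∑ i, v i • indicatorConstLp p hs (measure_ne_top μ s) (EuclideanSpace.single i (1 : ℝ)) := by
    change T v = ∑ i, v i • T (EuclideanSpace.single i (1 : ℝ))
    conv_lhs => rw [hv]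
    simp only [map_sum, map_smul]
  rw [h1, map_sum]
  simp only [map_smul, hgL, sum_inner, inner_smul_left]
  rw [integral_finsetSum _ fun i _ => ?_]
  · refine Finset.sum_congr rfl fun i _ => ?_
    simp [EuclideanSpace.inner_single_left, integral_mul_const, mul_comm]
  · exact ((hg i).mul_const _).integrableOn

end Representation

/-! ### Growth and subgradients of `H` -/

namespace GrowthH

variable {N : ℕ} {H : E N → ℝ} {p c d : ℝ}

theorem d_pos (hH : GrowthH H p c d) : 0 < d := hH.c_nonneg.trans_lt hH.c_lt_d

theorem continuous (hH : GrowthH H p c d) : Continuous H :=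
  continuousOn_univ.1 (hH.convex.continuousOn isOpen_univ)

theorem integrable_comp {α : Type*} [MeasurableSpace α] {μ : Measure α} (hH : GrowthH H p c d)
    (hp : 1 ≤ p) {G : α → E N} (hG : MemLp G (ENNReal.ofReal p) μ) :
    Integrable (fun x => H (G x)) μ := by
  have h := hG.integrable_norm_rpow (by simpa using zero_lt_one.trans_le hp) ENNReal.ofReal_ne_top
  rw [ENNReal.toReal_ofReal (by linarith)] at h
  refine (h.const_mul d).mono' (hH.continuous.comp_aestronglyMeasurable hG.1)
    (ae_of_all _ fun x => ?_)
  rw [Real.norm_of_nonneg (hH.nonneg _)]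
  exact hH.upper _

/-- Test the subgradient inequality with a vector of length `t ≥ ‖z‖` in the direction of `ξ`, and
use `0 ≤ H`. -/
theorem norm_le_of_mem_subdiff (hH : GrowthH H p c d) (hp : 1 ≤ p) {z ξ : E N}
    (hξ : ξ ∈ subdiff H z) : ‖ξ‖ ≤ d * 2 ^ p * ‖z‖ ^ (p - 1) := by
  have hd := hH.d_pos
  have key : ∀ t : ℝ, 0 < t → ‖z‖ ≤ t → ‖ξ‖ ≤ d * 2 ^ p * t ^ (p - 1) := by
    intro t ht hz
    rcases eq_or_ne ξ 0 with rfl | h0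
    · rw [norm_zero]
      positivity
    have hn : 0 < ‖ξ‖ := norm_pos_iff.2 h0
    have h := hξ ((t / ‖ξ‖) • ξ)
    rw [inner_smul_right, real_inner_self_eq_norm_sq] at h
    have h1 : H (z + (t / ‖ξ‖) • ξ) ≤ d * (2 * t) ^ p := by
      refine (hH.upper _).trans ?_
      gcongr
      refine (norm_add_le _ _).trans ?_
      rw [norm_smul, Real.norm_of_nonneg (by positivity), div_mul_cancel₀ _ hn.ne']
      linarith
    have h2 : t / ‖ξ‖ * ‖ξ‖ ^ 2 = t * ‖ξ‖ := by field_simp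
    have h3 : (2 * t) ^ p = 2 ^ p * (t ^ (p - 1) * t) := by
      rw [Real.mul_rpow (by norm_num) ht.le, Real.rpow_sub_one ht.ne', div_mul_cancel₀ _ ht.ne']
    have h4 := hH.nonneg z
    rw [h2] at h
    rw [h3] at h1
    refine le_of_mul_le_mul_left ?_ ht
    linarith
  -- Letting `t` decrease to `‖z‖` covers `z = 0`, where `t = ‖z‖` is not an admissible length.
  have hlim : Tendsto (fun t : ℝ => d * 2 ^ p * t ^ (p - 1)) (𝓝[>] ‖z‖)
      (𝓝 (d * 2 ^ p * ‖z‖ ^ (p - 1))) := by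
    refine Tendsto.mono_left ?_ nhdsWithin_le_nhds
    exact ((Real.continuous_rpow_const (by linarith)).tendsto ‖z‖).const_mul _
  refine ge_of_tendsto hlim ?_
  filter_upwards [self_mem_nhdsWithin] with t ht
  exact key t ((norm_nonneg z).trans_lt ht) (le_of_lt ht)

theorem memLp_of_mem_subdiff {α : Type*} [MeasurableSpace α] {μ : Measure α}
    (hH : GrowthH H p c d) (hp : 1 ≤ p) {G ξ : α → E N} (hG : MemLp G (ENNReal.ofReal p) μ)
    (hm : AEStronglyMeasurable ξ μ) (hξ : ∀ᵐ x ∂μ, ξ x ∈ subdiff H (G x)) :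
    MemLp ξ (ENNReal.conjExponent (ENNReal.ofReal p)) μ := by
  have hbd : ∀ᵐ x ∂μ, ‖ξ x‖ ≤ d * 2 ^ p * ‖G x‖ ^ (p - 1) :=
    hξ.mono fun x hx => hH.norm_le_of_mem_subdiff hp hx
  -- The form `p / (p - 1)` is also right for `p = 1`, since `1 / 0 = ⊤` in `ℝ≥0∞`.
  have hconj : ENNReal.conjExponent (ENNReal.ofReal p) =
      ENNReal.ofReal p / ENNReal.ofReal (p - 1) := by
    rw [ENNReal.conjExponent, ENNReal.ofReal_sub _ zero_le_one, ENNReal.ofReal_one]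
    rcases hp.eq_or_lt with rfl | h1
    · simp
    · have h1' : (1 : ℝ≥0∞) < ENNReal.ofReal p := by simpa using h1
      have h2 : ENNReal.ofReal p - 1 ≠ 0 := (tsub_pos_of_lt h1').ne'
      have h3 : ENNReal.ofReal p - 1 ≠ ⊤ := by simp
      conv_rhs => rw [← tsub_add_cancel_of_le h1'.le, ENNReal.add_sub_cancel_right (by simp)]
      rw [ENNReal.add_div, ENNReal.div_self h2 h3, one_div]
  have hr := (hG.norm_rpow_div (ENNReal.ofReal (p - 1))).const_mul (d * 2 ^ p)
  rw [ENNReal.toReal_ofReal (by linarith), ← hconj] at hr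
  exact hr.mono' hm hbd

/-- Reduces the subgradient inequality to countably many directions, so that their exceptional null
sets can be united. -/
theorem mem_subdiff_of_denseRange (hH : GrowthH H p c d) {ι : Type*} {D : ι → E N}
    (hD : DenseRange D) {z ξ : E N} (h : ∀ i, inner ℝ ξ (D i) ≤ H (z + D i) - H z) :
    ξ ∈ subdiff H z := fun v => by
  have hH' := hH.continuous
  have hcl : IsClosed {v : E N | inner ℝ ξ v ≤ H (z + v) - H z} :=
    isClosed_le (by fun_prop) (by fun_prop)
  exact hD.induction_on v hcl h

end GrowthH

/-! ### Subgradients of the integral functional -/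

section Representation

variable {α : Type*} [MeasurableSpace α] {μ : Measure α} {N : ℕ}
  {H : E N → ℝ} {p c d : ℝ} [Fact (1 ≤ ENNReal.ofReal p)]

/-- The majorant is bounded on the unit ball, and a linear functional bounded above there, at `g`
and at `-g`, is bounded. -/
theorem continuous_of_le_integral (hH : GrowthH H p c d) (hp : 1 ≤ p)
    {G : Lp (E N) (ENNReal.ofReal p) μ} {L : Lp (E N) (ENNReal.ofReal p) μ →ₗ[ℝ] ℝ}
    (hL : ∀ g, L g ≤ ∫ x, H ((G + g) x) ∂μ - ∫ x, H (G x) ∂μ) :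
    ∃ L' : Lp (E N) (ENNReal.ofReal p) μ →L[ℝ] ℝ, ∀ g, L' g = L g := by
  have hp0 : ENNReal.ofReal p ≠ 0 := by simpa using zero_lt_one.trans_le hp
  have hd := hH.d_pos
  have h1 : ∀ g, ‖g‖ ≤ 1 → L g ≤ d * (‖G‖ + 1) ^ p := by
    intro g hg
    have hint : Integrable (fun x => ‖(G + g) x‖ ^ p) μ := by
      have h := (Lp.memLp (G + g)).integrable_norm_rpow hp0 ENNReal.ofReal_ne_top
      rwa [ENNReal.toReal_ofReal (by linarith)] at h
    have h2 : ∫ x, H ((G + g) x) ∂μ ≤ d * ∫ x, ‖(G + g) x‖ ^ p ∂μ := by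
      rw [← integral_const_mul]
      exact integral_mono (hH.integrable_comp hp (Lp.memLp _)) (hint.const_mul d)
        fun x => hH.upper _
    have h3 : ∫ x, ‖(G + g) x‖ ^ p ∂μ = ‖G + g‖ ^ p := by
      have h := (Lp.memLp (G + g)).eLpNorm_eq_integral_rpow_norm hp0 ENNReal.ofReal_ne_top
      rw [ENNReal.toReal_ofReal (by linarith)] at h
      have hnn : 0 ≤ ∫ x, ‖(G + g) x‖ ^ p ∂μ := integral_nonneg fun x => by positivity
      rw [Lp.norm_def, h, ENNReal.toReal_ofReal (by positivity), ← Real.rpow_mul hnn,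
        inv_mul_cancel₀ (by linarith), Real.rpow_one]
    have h4 : ‖G + g‖ ^ p ≤ (‖G‖ + 1) ^ p := by
      gcongr
      exact (norm_add_le _ _).trans (by linarith)
    have h5 : 0 ≤ ∫ x, H (G x) ∂μ := integral_nonneg fun x => hH.nonneg _
    rw [h3] at h2
    have := hL g
    nlinarith [mul_le_mul_of_nonneg_left h4 hd.le]
  obtain ⟨C, hC⟩ := LinearMap.bound_of_ball_bound one_pos (d * (‖G‖ + 1) ^ p) L fun g hg => by
    rw [mem_ball_zero_iff] at hg
    rw [Real.norm_eq_abs, abs_le]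
    have := h1 (-g) (by rw [norm_neg]; exact hg.le)
    rw [map_neg] at this
    exact ⟨by linarith, h1 g hg.le⟩
  exact ⟨L.mkContinuous C hC, fun g => rfl⟩

/-- A linear functional on `L^p` in the subdifferential of `g ↦ ∫ H(g)` at `G` is represented by
a selection of `∂H(G)` in `L^{p'}`. -/
theorem exists_selection_of_le_integral [IsFiniteMeasure μ] (hH : GrowthH H p c d) (hp : 1 ≤ p)
    {G : Lp (E N) (ENNReal.ofReal p) μ} {L : Lp (E N) (ENNReal.ofReal p) μ →ₗ[ℝ] ℝ}
    (hL : ∀ g, L g ≤ ∫ x, H ((G + g) x) ∂μ - ∫ x, H (G x) ∂μ) :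
    ∃ ξ : α → E N, MemLp ξ (ENNReal.conjExponent (ENNReal.ofReal p)) μ ∧
      (∀ᵐ x ∂μ, ξ x ∈ subdiff H (G x)) ∧
      ∀ g : Lp (E N) (ENNReal.ofReal p) μ, L g = ∫ x, inner ℝ (ξ x) (g x) ∂μ := by
  obtain ⟨L', hL'⟩ := continuous_of_le_integral hH hp hL
  obtain ⟨ξ, hξi, hξ⟩ := exists_vector_density ENNReal.ofReal_ne_top L'
  have hG := hH.integrable_comp hp (Lp.memLp G)
  have hv : ∀ v : E N, ∀ᵐ x ∂μ, inner ℝ (ξ x) v ≤ H (G x + v) - H (G x) := by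
    intro v
    have hGv : Integrable (fun x => H (G x + v)) μ :=
      hH.integrable_comp (G := fun x => G x + v) hp ((Lp.memLp G).add (memLp_const v))
    -- Take `g = v 1_s`: off `s` the two integrands cancel, leaving the integrated inequality over
    -- `s`.
    refine ae_le_of_forall_setIntegral_le (hξi.inner_const v) (hGv.sub hG) fun s hs _ => ?_
    rw [← hξ s hs v, hL']
    refine (hL _).trans (le_of_eq ?_)
    rw [← integral_sub (hH.integrable_comp hp (Lp.memLp _)) hG, ← integral_indicator hs]
    refine integral_congr_ae ?_
    filter_upwards [Lp.coeFn_add G (indicatorConstLp (ENNReal.ofReal p) hs (measure_ne_top μ s) v),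
      indicatorConstLp_coeFn (p := ENNReal.ofReal p) (hs := hs) (hμs := measure_ne_top μ s)
        (c := v)] with x h1 h2
    rw [h1, Pi.add_apply, h2]
    by_cases hx : x ∈ s <;> simp [hx]
  have hsub : ∀ᵐ x ∂μ, ξ x ∈ subdiff H (G x) := by
    have := ae_all_iff.2 fun n => hv (TopologicalSpace.denseSeq (E N) n)
    filter_upwards [this] with x hx
    exact hH.mem_subdiff_of_denseRange (TopologicalSpace.denseRange_denseSeq (E N)) hx
  have hmem := hH.memLp_of_mem_subdiff hp (Lp.memLp G) hξi.1 hsub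
  refine ⟨ξ, hmem, hsub, ?_⟩
  have hfact : Fact (1 ≤ ENNReal.conjExponent (ENNReal.ofReal p)) := ⟨le_self_add⟩
  let B := (innerSL ℝ (E := E N)).lpPairing μ (ENNReal.conjExponent (ENNReal.ofReal p))
    (ENNReal.ofReal p) hmem.toLp
  have hB : ∀ g, B g = ∫ x, inner ℝ (ξ x) (g x) ∂μ := fun g => by
    rw [ContinuousLinearMap.lpPairing_eq_integral]
    refine integral_congr_ae ?_
    filter_upwards [hmem.coeFn_toLp] with x hx
    rw [hx, innerSL_apply_apply]
  intro g
  rw [← hB, ← hL']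
  -- Both functionals are continuous and agree on indicators, hence on all of `L^p`, as `p < ∞`.
  refine Lp.induction ENNReal.ofReal_ne_top (motive := fun g => L' g = B g) ?_ ?_ ?_ g
  · intro v s hs hμs
    rw [Lp.simpleFunc.coe_indicatorConst, hξ _ hs v, hB, ← integral_indicator hs]
    refine integral_congr_ae ?_
    filter_upwards [indicatorConstLp_coeFn (p := ENNReal.ofReal p) (hs := hs) (hμs := hμs.ne)
        (c := v)] with x h2
    rw [h2]
    by_cases hx : x ∈ s <;> simp [hx]
  · intro g h hg hh _ h1 h2
    rw [map_add, map_add, h1, h2]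
  · exact isClosed_eq L'.continuous B.continuous

end Representation

/-! ### Linear operations on test functions and on `W^{1,p}_0(Ω)` -/

section Test

variable {N : ℕ} {Ω : Set (E N)}

theorem gradient_fun_add {φ ψ : E N → ℝ} {x : E N} (hφ : DifferentiableAt ℝ φ x)
    (hψ : DifferentiableAt ℝ ψ x) :
    gradient (fun y => φ y + ψ y) x = gradient φ x + gradient ψ x := by
  simp only [gradient, fderiv_fun_add hφ hψ, map_add]

theorem gradient_fun_const_mul {φ : E N → ℝ} {x : E N} (hφ : DifferentiableAt ℝ φ x) (a : ℝ) :
    gradient (fun y => a * φ y) x = a • gradient φ x := by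
  simp only [gradient, fderiv_const_mul hφ, map_smul]

namespace IsTest

variable {φ ψ : E N → ℝ}

theorem differentiableAt (hφ : IsTest Ω φ) (x : E N) : DifferentiableAt ℝ φ x :=
  (hφ.smooth.differentiable (by simp)).differentiableAt

theorem add (hφ : IsTest Ω φ) (hψ : IsTest Ω ψ) : IsTest Ω (fun x => φ x + ψ x) where
  smooth := hφ.smooth.add hψ.smooth
  compact := hφ.compact.add hψ.compact
  supp := (tsupport_add φ ψ).trans (Set.union_subset hφ.supp hψ.supp)

theorem const_mul (hφ : IsTest Ω φ) (a : ℝ) : IsTest Ω (fun x => a * φ x) where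
  smooth := contDiff_const.mul hφ.smooth
  compact := hφ.compact.mul_left
  supp := (closure_mono (Function.support_mul_subset_right _ _)).trans hφ.supp

theorem continuous_gradient (hφ : IsTest Ω φ) : Continuous (gradient φ) :=
  (InnerProductSpace.toDual ℝ (E N)).symm.continuous.comp
    (hφ.smooth.continuous_fderiv (by simp))

theorem exists_norm_gradient_le (hφ : IsTest Ω φ) : ∃ C, ∀ x, ‖gradient φ x‖ ≤ C := by
  obtain ⟨C, hC⟩ := (hφ.compact.fderiv (𝕜 := ℝ)).exists_bound_of_continuous
    (hφ.smooth.continuous_fderiv (by simp))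
  exact ⟨C, fun x => by simpa [gradient] using hC x⟩

theorem integrable_smul_gradient {μ : Measure (E N)} (hφ : IsTest Ω φ) {u : E N → ℝ}
    (hu : Integrable u μ) : Integrable (fun x => u x • gradient φ x) μ := by
  obtain ⟨C, hC⟩ := hφ.exists_norm_gradient_le
  exact hu.smul_bdd C hφ.continuous_gradient.aestronglyMeasurable (ae_of_all _ hC)

theorem integrable_smul {μ : Measure (E N)} (hφ : IsTest Ω φ) {G : E N → E N}
    (hG : Integrable G μ) : Integrable (fun x => φ x • G x) μ := by
  obtain ⟨C, hC⟩ := hφ.compact.exists_bound_of_continuous hφ.smooth.continuous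
  exact hG.bdd_smul C hφ.smooth.continuous.aestronglyMeasurable (ae_of_all _ hC)

end IsTest

end Test

theorem tendsto_eLpNorm_add {α F : Type*} [MeasurableSpace α] {μ : Measure α}
    [NormedAddCommGroup F] {p : ℝ≥0∞} (hp : 1 ≤ p) {f g : ℕ → α → F}
    (hf : ∀ n, AEStronglyMeasurable (f n) μ) (hg : ∀ n, AEStronglyMeasurable (g n) μ)
    (hf0 : Tendsto (fun n => eLpNorm (f n) p μ) atTop (𝓝 0))
    (hg0 : Tendsto (fun n => eLpNorm (g n) p μ) atTop (𝓝 0)) :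
    Tendsto (fun n => eLpNorm (f n + g n) p μ) atTop (𝓝 0) := by
  have h := hf0.add hg0
  rw [add_zero] at h
  exact tendsto_of_tendsto_of_tendsto_of_le_of_le tendsto_const_nhds h (fun _ => zero_le)
    fun n => eLpNorm_add_le (hf n) (hg n) hp

theorem tendsto_eLpNorm_const_smul {α F : Type*} [MeasurableSpace α] {μ : Measure α}
    [NormedAddCommGroup F] [NormedSpace ℝ F] {p : ℝ≥0∞} (a : ℝ) {f : ℕ → α → F}
    (hf0 : Tendsto (fun n => eLpNorm (f n) p μ) atTop (𝓝 0)) :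
    Tendsto (fun n => eLpNorm (a • f n) p μ) atTop (𝓝 0) := by
  have h := ENNReal.Tendsto.const_mul (a := ‖a‖ₑ) hf0 (Or.inr enorm_ne_top)
  rw [mul_zero] at h
  simpa only [eLpNorm_const_smul] using h

namespace W0

variable {N : ℕ} {Ω : Set (E N)} {p : ℝ}

theorem integrable [IsFiniteMeasure (volume.restrict Ω)] (hp : 1 ≤ p) (v : W0 Ω p) :
    Integrable v.toFun (volume.restrict Ω) :=
  v.memLp.integrable (by simpa using hp)

theorem integrable_grad [IsFiniteMeasure (volume.restrict Ω)] (hp : 1 ≤ p) (v : W0 Ω p) :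
    Integrable v.grad (volume.restrict Ω) :=
  v.memLp_grad.integrable (by simpa using hp)

/-- The sum of two elements of `W^{1,p}_0(Ω)`. -/
def add [IsFiniteMeasure (volume.restrict Ω)] (hp : 1 ≤ p) (v w : W0 Ω p) : W0 Ω p where
  toFun x := v.toFun x + w.toFun x
  grad x := v.grad x + w.grad x
  memLp := v.memLp.add w.memLp
  memLp_grad := v.memLp_grad.add w.memLp_grad
  isWeakGrad φ hφ := by
    simp only [add_smul, smul_add]
    rw [integral_add (hφ.integrable_smul_gradient (v.integrable hp))
      (hφ.integrable_smul_gradient (w.integrable hp)),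
      integral_add (hφ.integrable_smul (v.integrable_grad hp))
      (hφ.integrable_smul (w.integrable_grad hp)), v.isWeakGrad φ hφ, w.isWeakGrad φ hφ, neg_add]
  approx := by
    obtain ⟨φ, hφ, hφ1, hφ2⟩ := v.approx
    obtain ⟨ψ, hψ, hψ1, hψ2⟩ := w.approx
    have hp' : 1 ≤ ENNReal.ofReal p := by simpa using hp
    refine ⟨fun n x => φ n x + ψ n x, fun n => (hφ n).add (hψ n), ?_, ?_⟩
    · convert! tendsto_eLpNorm_add hp'
        (fun n => (hφ n).smooth.continuous.aestronglyMeasurable.sub v.memLp.1)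
        (fun n => (hψ n).smooth.continuous.aestronglyMeasurable.sub w.memLp.1) hφ1 hψ1 using 3
      ext x
      simp only [Pi.add_apply, Pi.sub_apply]
      ring
    · convert! tendsto_eLpNorm_add hp'
        (fun n => (hφ n).continuous_gradient.aestronglyMeasurable.sub v.memLp_grad.1)
        (fun n => (hψ n).continuous_gradient.aestronglyMeasurable.sub w.memLp_grad.1)
        hφ2 hψ2 using 3 with n
      ext1 x
      simp only [Pi.add_apply, Pi.sub_apply]
      rw [gradient_fun_add ((hφ n).differentiableAt x) ((hψ n).differentiableAt x)]
      abel

/-- A multiple of an element of `W^{1,p}_0(Ω)`. -/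
def smul (a : ℝ) (v : W0 Ω p) : W0 Ω p where
  toFun x := a * v.toFun x
  grad x := a • v.grad x
  memLp := v.memLp.const_mul a
  memLp_grad := v.memLp_grad.const_smul a
  isWeakGrad φ hφ := by
    simp only [smul_comm _ a, mul_smul, integral_smul, v.isWeakGrad φ hφ, smul_neg]
  approx := by
    obtain ⟨φ, hφ, hφ1, hφ2⟩ := v.approx
    refine ⟨fun n x => a * φ n x, fun n => (hφ n).const_mul a, ?_, ?_⟩
    · convert! tendsto_eLpNorm_const_smul a hφ1 using 3
      ext x
      simp [mul_sub]
    · convert! tendsto_eLpNorm_const_smul a hφ2 using 3 with n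
      ext1 x
      rw [gradient_fun_const_mul ((hφ n).differentiableAt x), ← smul_sub]
      rfl

end W0

theorem integrable_inner_of_memLp {α : Type*} [MeasurableSpace α] {μ : Measure α} {N : ℕ} {p : ℝ}
    (hp : 1 ≤ p) {ξ G : α → E N} (hξ : MemLp ξ (ENNReal.conjExponent (ENNReal.ofReal p)) μ)
    (hG : MemLp G (ENNReal.ofReal p) μ) : Integrable (fun x => inner ℝ (ξ x) (G x)) μ := by
  have hfact : Fact (1 ≤ ENNReal.ofReal p) := ⟨by simpa using hp⟩
  exact memLp_one_iff_integrable.1 ((innerSL ℝ (E := E N)).memLp_of_bilin 1 hξ hG)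

/-! ### The Euler–Lagrange inclusion and Euler's identity -/

section Main

variable {N : ℕ} {Ω : Set (E N)} {p c d : ℝ} {H : E N → ℝ} {f : E N → ℝ → ℝ} {u v w : W0 Ω p}

theorem add_mem_V [IsFiniteMeasure (volume.restrict Ω)] (hp : 1 ≤ p) (hv : v ∈ V f u)
    (hw : w ∈ V f u) : W0.add hp v w ∈ V f u := by
  simpa only [V, W0.add, Set.mem_ofPred_eq, mul_add] using! Integrable.add hv hw

theorem smul_mem_V (a : ℝ) (hv : v ∈ V f u) : W0.smul a v ∈ V f u := by
  simpa only [V, W0.smul, Set.mem_ofPred_eq, mul_left_comm] using! Integrable.const_mul hv a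

theorem integral_mul_le [IsFiniteMeasure (volume.restrict Ω)] (hH : GrowthH H p c d) (hp : 1 ≤ p)
    (hu : IsEnergyCritical H f u) (hw : w ∈ V f u) :
    ∫ x in Ω, f x (u.toFun x) * w.toFun x ≤
      (∫ x in Ω, H (u.grad x + w.grad x)) - ∫ x in Ω, H (u.grad x) := by
  have h := hu.min _ (add_mem_V hp hu.mem hw)
  have hu' : Integrable (fun x => f x (u.toFun x) * u.toFun x) (volume.restrict Ω) := hu.mem
  have hw' : Integrable (fun x => f x (u.toFun x) * w.toFun x) (volume.restrict Ω) := hw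
  have hw'' := add_mem_V hp hu.mem hw
  unfold Jlin at h
  rw [integral_sub (hH.integrable_comp hp u.memLp_grad) hu',
    integral_sub (hH.integrable_comp hp (W0.memLp_grad _)) hw''] at h
  simp only [W0.add, mul_add] at h
  rw [integral_add hu' hw'] at h
  linarith

/-- The graph of `Dv ↦ ∫ f(x, u) v` for `v ∈ V_u`. -/
def forcingGraph [IsFiniteMeasure (volume.restrict Ω)] (hp : 1 ≤ p) (hu : u ∈ V f u) :
    Submodule ℝ (Lp (E N) (ENNReal.ofReal p) (volume.restrict Ω) × ℝ) where
  carrier := {g | ∃ v ∈ V f u, g = ((MemLp.toLp v.grad v.memLp_grad), ∫ x in Ω, f x (u.toFun x) * v.toFun x)}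
  add_mem' := by
    rintro _ _ ⟨v, hv, rfl⟩ ⟨w, hw, rfl⟩
    refine ⟨_, add_mem_V hp hv hw, ?_⟩
    simp only [W0.add, mul_add]
    rw [integral_add hv hw]
    rfl
  zero_mem' := ⟨W0.smul 0 u, smul_mem_V 0 hu, by
    refine Prod.ext ?_ (by simp [W0.smul])
    exact (zero_smul ℝ (MemLp.toLp u.grad u.memLp_grad)).symm⟩
  smul_mem' := by
    rintro a _ ⟨v, hv, rfl⟩
    refine ⟨_, smul_mem_V a hv, ?_⟩
    simp only [W0.smul, mul_left_comm _ a, integral_const_mul]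
    rfl

/-- This makes `forcingGraph` the graph of a function: if `Dv = 0`, minimality gives `∫ f(x,u) v ≤
0`, and likewise for `-v`. -/
theorem eq_zero_of_mem_forcingGraph [IsFiniteMeasure (volume.restrict Ω)]
    (hH : GrowthH H p c d) (hp : 1 ≤ p) (hu : IsEnergyCritical H f u)
    {g : Lp (E N) (ENNReal.ofReal p) (volume.restrict Ω) × ℝ}
    (hg : g ∈ forcingGraph hp hu.mem) (h0 : g.1 = 0) : g.2 = 0 := by
  have key : ∀ g ∈ forcingGraph hp hu.mem, g.1 = 0 → g.2 ≤ 0 := by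
    rintro _ ⟨v, hv, rfl⟩ h0
    have h := integral_mul_le hH hp hu hv
    have hv0 : v.grad =ᵐ[volume.restrict Ω] 0 := (MemLp.toLp_eq_toLp_iff v.memLp_grad MemLp.zero').1
      (h0.trans (MemLp.toLp_zero _).symm)
    have : ∫ x in Ω, H (u.grad x + v.grad x) = ∫ x in Ω, H (u.grad x) := by
      refine integral_congr_ae ?_
      filter_upwards [hv0] with x hx
      simp [hx]
    rw [this, sub_self] at h
    exact h
  refine le_antisymm (key g hg h0) ?_
  have := key (-g) (neg_mem hg) (by simp [h0])
  simpa using this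

theorem exists_solvesEL [IsFiniteMeasure (volume.restrict Ω)] (hH : GrowthH H p c d) (hp : 1 ≤ p)
    (hu : IsEnergyCritical H f u) : ∃ ξ, SolvesEL H f u ξ := by
  have hfact : Fact (1 ≤ ENNReal.ofReal p) := ⟨by simpa using hp⟩
  let S := forcingGraph hp hu.mem
  have hS : ∀ g ∈ S, g.1 = 0 → g.2 = 0 := fun g hg => eq_zero_of_mem_forcingGraph hH hp hu hg
  let Φ : Lp (E N) (ENNReal.ofReal p) (volume.restrict Ω) → ℝ := fun g => ∫ x in Ω, H (g x)
  have hi : ∀ g : Lp (E N) (ENNReal.ofReal p) (volume.restrict Ω),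
      Integrable (fun x => H (g x)) (volume.restrict Ω) :=
    fun g => hH.integrable_comp hp (Lp.memLp g)
  have hΦ : ConvexOn ℝ Set.univ Φ := by
    refine ⟨convex_univ, fun g _ h _ a b ha hb hab => ?_⟩
    have e : a • Φ g + b • Φ h = ∫ x in Ω, (a • H (g x) + b • H (h x)) :=
      ((integral_add ((hi g).smul a) ((hi h).smul b)).trans
        (congrArg₂ _ (integral_smul a _) (integral_smul b _))).symm
    rw [e]
    refine integral_mono_ae (hi _) (((hi g).smul a).add ((hi h).smul b)) ?_
    filter_upwards [Lp.coeFn_add (a • g) (b • h), Lp.coeFn_smul a g, Lp.coeFn_smul b h]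
      with x h1 h2 h3
    rw [h1, Pi.add_apply, h2, h3]
    exact hH.convex.2 (Set.mem_univ _) (Set.mem_univ _) ha hb hab
  let G := (MemLp.toLp u.grad u.memLp_grad)
  have hΦ' : ∀ w : W0 Ω p, Φ (G + (MemLp.toLp w.grad w.memLp_grad)) = ∫ x in Ω, H (u.grad x + w.grad x) := by
    intro w
    refine integral_congr_ae ?_
    filter_upwards [Lp.coeFn_add G (MemLp.toLp w.grad w.memLp_grad), u.memLp_grad.coeFn_toLp,
      w.memLp_grad.coeFn_toLp] with x h1 h2 h3
    rw [h1, Pi.add_apply, h2, h3]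
  have hΦG : Φ G = ∫ x in Ω, H (u.grad x) := by
    refine integral_congr_ae ?_
    filter_upwards [u.memLp_grad.coeFn_toLp] with x h1
    rw [h1]
  have hl : ∀ g : S.toLinearPMap.domain, S.toLinearPMap g ≤ Φ (G + g) - Φ G := by
    intro g
    obtain ⟨w, hw, hgw⟩ := Submodule.mem_graph_toLinearPMap hS g
    rw [Prod.mk.injEq] at hgw
    rw [hgw.2, hgw.1, hΦ', hΦG]
    exact integral_mul_le hH hp hu hw
  obtain ⟨L, hL, hL'⟩ := exists_extension_of_le_convex hΦ G S.toLinearPMap hl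
  obtain ⟨ξ, hξ, hsub, hrep⟩ := exists_selection_of_le_integral hH hp hL'
  refine ⟨ξ, hξ, ?_, fun φ hφ => ?_⟩
  · filter_upwards [hsub, u.memLp_grad.coeFn_toLp] with x h1 h2
    rwa [h2] at h1
  · have hmem : ((MemLp.toLp φ.grad φ.memLp_grad), ∫ x in Ω, f x (u.toFun x) * φ.toFun x) ∈ S := ⟨φ, hφ, rfl⟩
    rw [← Submodule.toLinearPMap_graph_eq S hS, LinearPMap.mem_graph_iff] at hmem
    obtain ⟨y, hy1, hy2⟩ := hmem
    have h1 := hL y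
    rw [hy1, hy2, hrep] at h1
    have h2 : ∫ x in Ω, inner ℝ (ξ x) ((MemLp.toLp φ.grad φ.memLp_grad) x) =
        ∫ x in Ω, inner ℝ (ξ x) (φ.grad x) := by
      refine integral_congr_ae ?_
      filter_upwards [φ.memLp_grad.coeFn_toLp] with x hx
      rw [hx]
    rw [h2] at h1
    rw [integral_sub (integrable_inner_of_memLp hp hξ φ.memLp_grad) hφ, h1, sub_self]

/-- The difference of the two sides is nonnegative near `t = 0` and vanishes there, so its
derivative `p h - a` is zero. -/
theorem mul_eq_of_forall_le {p a h : ℝ}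
    (hle : ∀ t : ℝ, -1 < t → t * a ≤ (1 + t) ^ p * h - h) : a = p * h := by
  have hd : HasDerivAt (fun t : ℝ => (1 + t) ^ p * h - h - t * a) (p * h - a) 0 := by
    have h1 : HasDerivAt (fun t : ℝ => 1 + t) 1 0 := (hasDerivAt_id (0 : ℝ)).const_add 1
    have h2 := h1.rpow_const (p := p) (Or.inl (by simp))
    simpa using! ((h2.mul_const h).sub_const h).sub ((hasDerivAt_id (0 : ℝ)).mul_const a)
  have hmin : IsLocalMin (fun t : ℝ => (1 + t) ^ p * h - h - t * a) 0 := by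
    filter_upwards [Ioi_mem_nhds (show (-1 : ℝ) < 0 by norm_num)] with t ht
    have := hle t ht
    simp
    linarith
  linarith [hmin.hasDerivAt_eq_zero hd]

/-- Euler's identity for the subdifferential of a positively homogeneous function. -/
theorem PosHomogeneous.inner_eq (hH : PosHomogeneous H p) {z ξ : E N} (hξ : ξ ∈ subdiff H z) :
    inner ℝ ξ z = p * H z := by
  -- Move along the ray of `z`: `t > -1` keeps `1 + t` positive, as homogeneity requires, and allows
  -- both signs of `t`.
  refine mul_eq_of_forall_le fun t ht => ?_
  have h := hξ (t • z)
  rw [inner_smul_right] at h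
  have e : z + t • z = (1 + t) • z := by rw [add_smul, one_smul]
  rwa [e, hH (1 + t) (by linarith) z] at h

end Main
end EnergyCritical

theorem mainTheorem7 {N : ℕ} (hN : 1 ≤ N) (Ω : Set (EnergyCritical.E N)) (hΩ : IsOpen Ω)
    (hΩfin : volume Ω < ⊤) (p c d : ℝ) (hp : 1 ≤ p)
    (H : EnergyCritical.E N → ℝ) (hH : EnergyCritical.GrowthH H p c d)
    (f : EnergyCritical.E N → ℝ → ℝ) (hf : EnergyCritical.LocBddCaratheodory Ω f)
    (hfg : p ≤ N → EnergyCritical.OneSidedGrowth Ω p f)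
    (u : EnergyCritical.W0 Ω p) (hu : EnergyCritical.IsEnergyCritical H f u) :
    (∃ ξ : EnergyCritical.E N → EnergyCritical.E N, EnergyCritical.SolvesEL H f u ξ) ∧
    (EnergyCritical.PosHomogeneous H p →
      (∀ ξ : EnergyCritical.E N → EnergyCritical.E N, EnergyCritical.SolvesEL H f u ξ →
        ∀ᵐ x ∂(volume.restrict Ω), inner ℝ (ξ x) (u.grad x) = p * H (u.grad x)) ∧
      p * ∫ x in Ω, H (u.grad x) = ∫ x in Ω, f x (u.toFun x) * u.toFun x) := by
  have hfin : IsFiniteMeasure (volume.restrict Ω) := ⟨by simpa using hΩfin⟩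
  obtain ⟨ξ, hξ⟩ := EnergyCritical.exists_solvesEL hH hp hu
  have hEuler : EnergyCritical.PosHomogeneous H p →
      ∀ ξ : EnergyCritical.E N → EnergyCritical.E N, EnergyCritical.SolvesEL H f u ξ →
        ∀ᵐ x ∂(volume.restrict Ω), inner ℝ (ξ x) (u.grad x) = p * H (u.grad x) :=
    fun hhom ξ hξ => hξ.mem_subdiff.mono fun x hx => hhom.inner_eq hx
  refine ⟨⟨ξ, hξ⟩, fun hhom => ⟨hEuler hhom, ?_⟩⟩
  have h := hξ.eq u hu.mem
  rw [integral_sub (EnergyCritical.integrable_inner_of_memLp hp hξ.memLp u.memLp_grad) hu.mem,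
    sub_eq_zero, integral_congr_ae (hEuler hhom ξ hξ), integral_const_mul] at h
  exact h
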